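/- Let $E$ be a complex Banach space and let $\bar E'$ be its conjugate topological dual, i.e. the Banach space of continuous conjugate-linear functionals $f:E\to\mathbb{C}$ with the functional norm; write $\langle f,x\rangle:=f(x)$. Let $\operatorname{dom}A\subseteq E$ be a linear subspace (not assumed closed or dense) and let $A:\operatorname{dom}A\to\bar E'$ be a linear operator. A continuous linear operator $T:E\to\bar E'$ is called positive, $T\ge 0$, if $\langle Tx,x\rangle$ is real and $\geq 0$ for all $x\in E$, and $S\le T$ means $T-S\ge 0$. An inequality $r\le z$ with $r$ real and $z\in\mathbb{C}$ means that $z$ is real and $r\le z$. Then the following statements are equivalent. (i) $A$ has a continuous positive extension $\widetilde A:E\to\bar E'$. (ii) There is a constant $M\ge 0$ such that $\|Ax\|^2\le M\,\langle Ax,x\rangle$ for all $x\in\operatorname{dom}A$. (iii) For every $y\in E$ there is $M_y\ge 0$ such that $|\langle Ax,y\rangle|^2\le M_y\,\langle Ax,x\rangle$ for all $x\in\operatorname{dom}A$. Suppose that one (hence each) of these conditions holds. Then the Krein–von Neumann extension $A_N:E\to\bar E'$ of $A$ exists. This is the uniquely determined operator $A_N=JJ^*$, where $H_A$ is the Hilbert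 space completion of $\operatorname{ran}A$ with respect to the inner product $(Ax\,|\,Ax')_A:=\langle Ax,x'\rangle$, $J:H_A\to\bar E'$ is the continuous linear extension of the embedding $\operatorname{ran}A\ni Ax\mapsto Ax\in\bar E'$, and $J^*:E\to H_A$ is the adjoint of $J$, given by $\langle Jh,x\rangle=(h\,|\,J^*x)_A$. It is a continuous positive extension of $A$, and it is the smallest one: $A_N\le\widetilde A$ for every continuous positive extension $\widetilde A:E\to\bar E'$ of $A$. Its norm is $$\|A_N\|=\inf\{M\ge 0:\ \|Ax\|^2\le M\,\langle Ax,x\rangle\ \text{ for all } x\in\operatorname{dom}A\}.$$ Moreover, for a continuous linear operator $T:E\to E$ let $T^*:\bar E'\to\bar E'$ be its adjoint, $\langle T^*f,x\rangle=\langle f,Tx\rangle$. If $B,C:E\to E$ are continuous linear operators that leave $\operatorname{dom}A$ invariant and satisfy $C^*Ax=ABx$ and $B^*Ax=ACx$ for all $x\in\operatorname{dom}A$, then $$C^*A_N=A_NB\qquad\text{and}\qquad B^*A_N=A_NC.$$ -/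

import Mathlib

open scoped ComplexOrder InnerProductSpace

universe u

namespace BanachExtension

/-- The conjugate topological dual of a complex normed space `E`: the continuous conjugate-linear
functionals on `E`, with the functional norm. The anti-duality is evaluation, `⟨f, x⟩ = f x`, which
is linear in `f` and conjugate linear in `x`. -/
abbrev AntiDual (E : Type u) [NormedAddCommGroup E] [NormedSpace ℂ E] : Type u :=
  E →L⋆[ℂ] ℂ

variable {E : Type u} [NormedAddCommGroup E] [NormedSpace ℂ E]

/-- An everywhere defined operator `T` is positive if `⟨Tx, x⟩` is real and nonnegative for
every `x` (the order is the one of `ℂ`, in which `0 ≤ z` says that `z` is real and nonnegative). -/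
def IsPositive (T : E →L[ℂ] AntiDual E) : Prop :=
  ∀ x : E, 0 ≤ T x x

/-- The everywhere defined operator `T` extends the operator `A` given on a linear subspace. -/
def Extends (T : E →L[ℂ] AntiDual E) (A : E →ₗ.[ℂ] AntiDual E) : Prop :=
  ∀ x : A.domain, T (x : E) = A x

/-- `T` is a continuous positive extension of `A` to the whole space. -/
def IsPositiveExtension (A : E →ₗ.[ℂ] AntiDual E) (T : E →L[ℂ] AntiDual E) : Prop :=
  Extends T A ∧ IsPositive T

/-- `‖Ax‖² ≤ M ⟨Ax, x⟩` on the domain of `A`. The inequality is between complex numbers, so it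
contains the assertion that the right-hand side is real. -/
def NormBound (A : E →ₗ.[ℂ] AntiDual E) (M : ℝ) : Prop :=
  ∀ x : A.domain, ((‖A x‖ ^ 2 : ℝ) : ℂ) ≤ (M : ℂ) * A x (x : E)

/-- `|⟨Ax, y⟩|² ≤ M ⟨Ax, x⟩` on the domain of `A`, for a fixed vector `y`; again an inequality
between complex numbers. -/
def PointBound (A : E →ₗ.[ℂ] AntiDual E) (y : E) (M : ℝ) : Prop :=
  ∀ x : A.domain, ((‖A x y‖ ^ 2 : ℝ) : ℂ) ≤ (M : ℂ) * A x (x : E)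

/-- The adjoint `C* : AntiDual E → AntiDual E` of a continuous operator `C` on `E`,
`⟨C* f, x⟩ = ⟨f, C x⟩`. -/
noncomputable def adj (C : E →L[ℂ] E) : AntiDual E →L[ℂ] AntiDual E :=
  ContinuousLinearMap.precomp ℂ C

theorem adj_apply (C : E →L[ℂ] E) (f : AntiDual E) (x : E) : adj C f x = f (C x) := rfl

/-- `T` is the Krein–von Neumann extension of `A`, as it is constructed: `T = J J*`, where
* `H` together with `ι : ran A → H` is the Hilbert space completion of the range of `A` for the
  inner product `(Ax | Ax') = ⟨Ax, x'⟩` (Mathlib's inner product is linear in the second variable,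
  so that `(h | k)` is `⟪k, h⟫_ℂ`);
* `J : H → AntiDual E` is the continuous extension of the embedding `Ax ↦ Ax` of `ran A`;
* `J* : E → H` is the adjoint of `J`, `⟨J h, x⟩ = (h | J* x)`. -/
def IsKreinVonNeumannExtension (A : E →ₗ.[ℂ] AntiDual E) (T : E →L[ℂ] AntiDual E) : Prop :=
  ∃ (H : Type u) (_ : NormedAddCommGroup H) (_ : InnerProductSpace ℂ H) (_ : CompleteSpace H)
    (ι : LinearMap.range A.toFun →ₗ[ℂ] H) (J : H →L[ℂ] AntiDual E) (Jstar : E →L[ℂ] H),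
    DenseRange ι ∧
    (∀ x x' : A.domain,
      ⟪ι (A.toFun.rangeRestrict x'), ι (A.toFun.rangeRestrict x)⟫_ℂ = A x (x' : E)) ∧
    (∀ f : LinearMap.range A.toFun, J (ι f) = f) ∧
    (∀ (h : H) (x : E), J h x = ⟪Jstar x, h⟫_ℂ) ∧
    T = J ∘L Jstar

end BanachExtension

open scoped ComplexOrder InnerProductSpace

/-! Everything takes place in the energy space `H`, the completion of `ran A` under `(Ax | Ax') =
⟨Ax, x'⟩`. The bound in (ii) says exactly that the inclusion of `ran A` into the antidual is bounded
for the energy norm, so it extends to `J`. Testing against the dense range gives `J* x = Ax` on `dom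
A`, hence `J J*` extends `A`, and it is positive because `⟨J J* x, x⟩ = ‖J* x‖²`. Cauchy–Schwarz for
any positive extension yields (ii), minimality and, with `‖J‖, ‖J*‖ ≤ √M`, the norm formula.
Minimality in turn gives uniqueness. The step from (iii) to (ii) is Banach–Steinhaus for the
functionals `Ax / √⟨Ax, x⟩`.

For the intertwining relations, `Ax ↦ ABx` must be bounded in the energy norm although `B` is only
bounded on `E`. Since `CB` is symmetric for the energy form, iterated Cauchy–Schwarz bounds it by
the growth rate of its powers, which is controlled in `E` (`le_mul_of_sq_le_of_le_pow`,
`exists_norm_le`). -/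

namespace BanachExtension

/-! ### Nonnegative sesquilinear forms and completions -/

section Sesquilinear

variable {V : Type*} [AddCommGroup V] [Module ℂ V] {S : V →ₗ[ℂ] V →ₗ⋆[ℂ] ℂ}

/-- A complex sesquilinear form with nonnegative quadratic form is Hermitian. -/
theorem conj_form_of_nonneg (hS : ∀ x, 0 ≤ S x x) (x y : V) :
    (starRingEnd ℂ) (S y x) = S x y := by
  have him : ∀ z, (S z z).im = 0 := fun z => (Complex.nonneg_iff.1 (hS z)).2.symm
  -- Polarization: reality of the form at `x + y` gives the imaginary part of the identity, at `x +
  -- I • y` the real part.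
  have h1 := him (x + y)
  have h2 := him (x + Complex.I • y)
  have hx := him x
  have hy := him y
  simp at h1 h2
  apply Complex.ext
  · simp
    linarith
  · simp
    linarith

/-- The (possibly degenerate) inner product `(x, y) ↦ S y x` given by a nonnegative sesquilinear
form. -/
@[reducible]
def preInnerCore (hS : ∀ x, 0 ≤ S x x) : PreInnerProductSpace.Core ℂ V where
  inner x y := S y x
  conj_inner_symm x y := conj_form_of_nonneg hS y x
  re_inner_nonneg x := (Complex.nonneg_iff.1 (hS x)).1
  add_left x y z := map_add (S z) x y
  smul_left x y r := by simp

/-- The Cauchy–Schwarz inequality for a nonnegative sesquilinear form. -/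
theorem norm_form_sq_le (hS : ∀ x, 0 ≤ S x x) (x y : V) :
    ‖S x y‖ ^ 2 ≤ (S x x).re * (S y y).re := by
  have h := @InnerProductSpace.Core.inner_mul_inner_self_le ℂ V _ _ _ (preInnerCore hS) y x
  change ‖S x y‖ * ‖S y x‖ ≤ (S y y).re * (S x x).re at h
  rw [← conj_form_of_nonneg hS y x, RCLike.norm_conj] at h
  linarith

/-- A sesquilinear form over `ℂ` whose quadratic form vanishes is zero. -/
theorem form_eq_zero (hS : ∀ x, S x x = 0) (x y : V) : S x y = 0 := by
  have h := norm_form_sq_le (fun z => (hS z).ge) x y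
  rw [hS x] at h
  simpa using h

/-- Continuous extension of a linear map along a linear map with dense range. -/
theorem exists_extension_of_norm_le {H F : Type*} [NormedAddCommGroup H] [NormedSpace ℂ H]
    [NormedAddCommGroup F] [NormedSpace ℂ F] [CompleteSpace F] (f : V →ₗ[ℂ] F) (e : V →ₗ[ℂ] H)
    (he : DenseRange e) {C : ℝ} (hC : ∀ x, ‖f x‖ ≤ C * ‖e x‖) :
    ∃ g : H →L[ℂ] F, ∀ x, g (e x) = f x :=
  ⟨f.extendOfNorm e, LinearMap.extendOfNorm_eq he ⟨C, hC⟩⟩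

/-- The Hausdorff completion of a complex vector space with a (possibly degenerate) inner
product. -/
theorem exists_hilbert_completion {V : Type u} [AddCommGroup V] [Module ℂ V]
    (c : PreInnerProductSpace.Core ℂ V) :
    ∃ (H : Type u) (_ : NormedAddCommGroup H) (_ : InnerProductSpace ℂ H) (_ : CompleteSpace H)
      (κ : V →ₗ[ℂ] H), DenseRange κ ∧ ∀ x y, ⟪κ x, κ y⟫_ℂ = c.inner x y := by
  let _ : SeminormedAddCommGroup V :=
    @InnerProductSpace.Core.toSeminormedAddCommGroup ℂ V _ _ _ c
  let _ : InnerProductSpace ℂ V := InnerProductSpace.ofCore c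
  exact ⟨UniformSpace.Completion V, inferInstance, inferInstance, inferInstance,
    (UniformSpace.Completion.toComplL (𝕜 := ℂ) (E := V)).toLinearMap,
    UniformSpace.Completion.denseRange_coe, fun x y => UniformSpace.Completion.inner_coe x y⟩

end Sesquilinear

/-! ### Positive operators and the three conditions -/

variable {E : Type u} [NormedAddCommGroup E] [NormedSpace ℂ E]

/-- The sesquilinear form `(x, y) ↦ ⟨Tx, y⟩` of an everywhere defined operator. -/
noncomputable def form (T : E →L[ℂ] AntiDual E) : E →ₗ[ℂ] E →ₗ⋆[ℂ] ℂ :=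
  LinearMap.mk₂'ₛₗ (RingHom.id ℂ) (starRingEnd ℂ) (fun x y => T x y)
    (by simp) (by simp) (by simp) (by simp)

theorem form_apply (T : E →L[ℂ] AntiDual E) (x y : E) : form T x y = T x y := rfl

/-- The sesquilinear form `(x, y) ↦ ⟨Ax, y⟩` of a partially defined operator, on its domain. -/
noncomputable def domForm (A : E →ₗ.[ℂ] AntiDual E) : A.domain →ₗ[ℂ] A.domain →ₗ⋆[ℂ] ℂ :=
  LinearMap.mk₂'ₛₗ (RingHom.id ℂ) (starRingEnd ℂ) (fun x y => A x (y : E))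
    (by simp [LinearPMap.map_add]) (by simp [LinearPMap.map_smul]) (by simp) (by simp)

theorem IsPositive.norm_sq_le {T : E →L[ℂ] AntiDual E} (hT : IsPositive T) (x y : E) :
    ‖T x y‖ ^ 2 ≤ (T x x).re * (T y y).re :=
  norm_form_sq_le (S := form T) hT x y

theorem eq_of_isPositive_sub {S T : E →L[ℂ] AntiDual E} (h₁ : IsPositive (S - T))
    (h₂ : IsPositive (T - S)) : S = T := by
  have h : ∀ x, form (S - T) x x = 0 := fun x => by
    refine le_antisymm ?_ (h₁ x)
    have := h₂ x
    rw [← neg_sub S T] at this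
    simpa [form_apply] using this
  refine sub_eq_zero.1 (ContinuousLinearMap.ext fun x => ContinuousLinearMap.ext fun y => ?_)
  exact form_eq_zero h x y

theorem ofReal_le_ofReal_mul_iff {a M : ℝ} {z : ℂ} (hz : 0 ≤ z) :
    (a : ℂ) ≤ (M : ℂ) * z ↔ a ≤ M * z.re := by
  obtain ⟨r, rfl⟩ : ∃ r : ℝ, z = r := ⟨z.re, Complex.ext rfl (Complex.nonneg_iff.1 hz).2.symm⟩
  rw [← Complex.ofReal_mul, Complex.real_le_real, Complex.ofReal_re]

/-- An inequality `0 ≤ a ≤ M z` with `a = 0 → z = 0` and `M ≥ 0` forces `0 ≤ z`. -/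
theorem nonneg_of_ofReal_le_mul {a M : ℝ} {z : ℂ} (ha : 0 ≤ a) (haz : a = 0 → z = 0)
    (hM : 0 ≤ M) (h : (a : ℂ) ≤ (M : ℂ) * z) : 0 ≤ z := by
  rcases hM.eq_or_lt with rfl | hM
  · have h0 : a ≤ 0 := by
      rw [Complex.ofReal_zero, zero_mul] at h
      exact_mod_cast h
    exact (haz (le_antisymm h0 ha)).ge
  · have h0 : (0 : ℂ) ≤ (M : ℂ) * z := le_trans (by exact_mod_cast ha) h
    have hM' : (0 : ℂ) ≤ ((M⁻¹ : ℝ) : ℂ) := by exact_mod_cast (inv_pos.2 hM).le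
    have := mul_nonneg hM' h0
    rwa [← mul_assoc, ← Complex.ofReal_mul, inv_mul_cancel₀ hM.ne', Complex.ofReal_one,
      one_mul] at this

variable {A : E →ₗ.[ℂ] AntiDual E}

theorem NormBound.nonneg {M : ℝ} (hM : 0 ≤ M) (h : NormBound A M) (x : A.domain) :
    0 ≤ A x (x : E) :=
  nonneg_of_ofReal_le_mul (sq_nonneg _) (fun h0 => by
    have : A x = 0 := by simpa using h0
    simp [this]) hM (h x)

theorem IsPositiveExtension.nonneg {T : E →L[ℂ] AntiDual E} (hT : IsPositiveExtension A T)
    (x : A.domain) : 0 ≤ A x (x : E) := by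
  rw [← hT.1 x]
  exact hT.2 x

/-- Cauchy–Schwarz for the form of `T` gives `|⟨Ax, y⟩|² ≤ ⟨Ax, x⟩ ⟨Ty, y⟩ ≤ ⟨Ax, x⟩ ‖T‖ ‖y‖²`. The
sharp constant `‖T‖` is what the norm formula needs. -/
theorem IsPositiveExtension.normBound {T : E →L[ℂ] AntiDual E} (hT : IsPositiveExtension A T) :
    NormBound A ‖T‖ := by
  intro x
  rw [ofReal_le_ofReal_mul_iff (hT.nonneg x)]
  have hx := (Complex.nonneg_iff.1 (hT.nonneg x)).1
  have h : ‖A x‖ ≤ √(‖T‖ * (A x (x : E)).re) := by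
    refine ContinuousLinearMap.opNorm_le_bound _ (Real.sqrt_nonneg _) fun y => ?_
    refine abs_le_of_sq_le_sq' ?_ (by positivity) |>.2
    rw [mul_pow, Real.sq_sqrt (by positivity)]
    have h1 := hT.2.norm_sq_le (x : E) y
    rw [hT.1 x] at h1
    have h2 : (T y y).re ≤ ‖T‖ * ‖y‖ * ‖y‖ :=
      (Complex.re_le_norm _).trans (T.le_opNorm₂ y y)
    nlinarith [mul_le_mul_of_nonneg_left h2 hx]
  calc ‖A x‖ ^ 2 ≤ √(‖T‖ * (A x (x : E)).re) ^ 2 := by gcongr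
    _ = _ := Real.sq_sqrt (by positivity)

theorem NormBound.pointBound {M : ℝ} (hM : 0 ≤ M) (h : NormBound A M) (y : E) :
    PointBound A y (M * ‖y‖ ^ 2) := by
  intro x
  have hn := h.nonneg hM x
  have hx := (ofReal_le_ofReal_mul_iff hn).1 (h x)
  rw [ofReal_le_ofReal_mul_iff hn]
  calc ‖A x y‖ ^ 2 ≤ (‖A x‖ * ‖y‖) ^ 2 := by gcongr; exact (A x).le_opNorm y
    _ = ‖A x‖ ^ 2 * ‖y‖ ^ 2 := mul_pow _ _ _
    _ ≤ M * (A x (x : E)).re * ‖y‖ ^ 2 := by gcongr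
    _ = _ := by ring

/-- Pointwise bounds are uniform, by the Banach–Steinhaus theorem. -/
theorem exists_normBound_of_pointBound [CompleteSpace E]
    (h : ∀ y : E, ∃ M : ℝ, 0 ≤ M ∧ PointBound A y M) : ∃ M : ℝ, 0 ≤ M ∧ NormBound A M := by
  have hn : ∀ x : A.domain, 0 ≤ A x (x : E) := fun x => by
    obtain ⟨M, hM, hb⟩ := h x
    exact nonneg_of_ofReal_le_mul (sq_nonneg _) (fun h0 => by simpa using h0) hM (hb x)
  -- Where `⟨Ax, x⟩ = 0` the inverse is `0` by convention, so the normalized family is defined and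
  -- pointwise bounded on all of `dom A`.
  have hb : ∀ y : E, ∃ C : ℝ, ∀ x : A.domain,
      ‖((((√(A x (x : E)).re)⁻¹ : ℝ) : ℂ) • A x) y‖ ≤ C := fun y => by
    obtain ⟨M, hM, hb⟩ := h y
    refine ⟨√M, fun x => ?_⟩
    have hx := (ofReal_le_ofReal_mul_iff (hn x)).1 (hb x)
    have hr := (Complex.nonneg_iff.1 (hn x)).1
    have hA : ‖A x y‖ ≤ √M * √(A x (x : E)).re := by
      rw [← Real.sqrt_mul hM]
      exact Real.le_sqrt_of_sq_le hx
    rw [smul_apply, norm_smul, Complex.norm_real,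
      Real.norm_of_nonneg (by positivity)]
    rcases (Real.sqrt_nonneg (A x (x : E)).re).eq_or_lt with h0 | h0
    · rw [← h0]
      simp
    · rw [inv_mul_le_iff₀ h0]
      linarith
  obtain ⟨C, hC⟩ := banach_steinhaus hb
  refine ⟨C ^ 2, sq_nonneg _, fun x => ?_⟩
  rw [ofReal_le_ofReal_mul_iff (hn x)]
  have hr := (Complex.nonneg_iff.1 (hn x)).1
  have hx := hC x
  rw [norm_smul, Complex.norm_real, Real.norm_of_nonneg (by positivity)] at hx
  rcases (Real.sqrt_nonneg (A x (x : E)).re).eq_or_lt with h0 | h0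
  -- Here the normalized functional is zero and carries no information; the pointwise bounds
  -- themselves force `Ax = 0`.
  · have h00 : (A x (x : E)).re = 0 := (Real.sqrt_eq_zero hr).1 h0.symm
    have hA : A x = 0 := by
      ext y
      obtain ⟨M, hM, hb⟩ := h y
      have hx := (ofReal_le_ofReal_mul_iff (hn x)).1 (hb x)
      rw [h00, mul_zero] at hx
      simpa using hx
    simp [hA]
  · rw [inv_mul_le_iff₀ h0] at hx
    calc ‖A x‖ ^ 2 ≤ (√(A x (x : E)).re * C) ^ 2 := by gcongr
      _ = C ^ 2 * (A x (x : E)).re := by rw [mul_pow, Real.sq_sqrt hr, mul_comm]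

/-! ### The factorization `J J*`: extension, minimality, norm -/

section Factorization

variable {H : Type u} [NormedAddCommGroup H] [InnerProductSpace ℂ H]

/-- The data `ι`, `J`, `J*` of the factorization through the completion `H` of `ran A`. -/
structure IsFactorization (A : E →ₗ.[ℂ] AntiDual E) (ι : LinearMap.range A.toFun →ₗ[ℂ] H)
    (J : H →L[ℂ] AntiDual E) (Jstar : E →L[ℂ] H) : Prop where
  dense : DenseRange ι
  inner_range : ∀ x x' : A.domain,
    ⟪ι (A.toFun.rangeRestrict x'), ι (A.toFun.rangeRestrict x)⟫_ℂ = A x (x' : E)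
  map_range : ∀ f : LinearMap.range A.toFun, J (ι f) = f
  adjoint : ∀ (h : H) (x : E), J h x = ⟪Jstar x, h⟫_ℂ

namespace IsFactorization

variable {ι : LinearMap.range A.toFun →ₗ[ℂ] H} {J : H →L[ℂ] AntiDual E} {Jstar : E →L[ℂ] H}

/-- A closed property holds on all of `H` if it holds for the vectors `ι (Ax)`. -/
theorem induction (hF : IsFactorization A ι J Jstar) {p : H → Prop}
    (hp : IsClosed {h | p h}) (h : ∀ x : A.domain, p (ι (A.toFun.rangeRestrict x))) (k : H) :
    p k := by
  refine hF.dense.induction (fun y => ?_) hp k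
  rintro ⟨⟨f, x, rfl⟩, rfl⟩
  exact h x

theorem norm_sq_range (hF : IsFactorization A ι J Jstar) (x : A.domain) :
    ‖ι (A.toFun.rangeRestrict x)‖ ^ 2 = (A x (x : E)).re := by
  rw [← hF.inner_range x x]
  exact norm_sq_eq_re_inner (𝕜 := ℂ) _

theorem map_rangeRestrict (hF : IsFactorization A ι J Jstar) (x : A.domain) :
    J (ι (A.toFun.rangeRestrict x)) = A x :=
  hF.map_range _

theorem inner_Jstar_range (hF : IsFactorization A ι J Jstar) (y : E) (x : A.domain) :
    ⟪Jstar y, ι (A.toFun.rangeRestrict x)⟫_ℂ = A x y := by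
  rw [← hF.adjoint, hF.map_rangeRestrict]

/-- Both vectors have inner product `⟨Az, x⟩` with each `ι (Az)`, and these are dense. -/
theorem Jstar_apply (hF : IsFactorization A ι J Jstar) (x : A.domain) :
    Jstar (x : E) = ι (A.toFun.rangeRestrict x) := by
  refine ext_inner_right ℂ fun k => ?_
  refine hF.induction (p := fun k => ⟪Jstar (x : E), k⟫_ℂ = _) (isClosed_eq (by fun_prop)
    (by fun_prop)) (fun z => ?_) k
  rw [hF.inner_Jstar_range, hF.inner_range]

theorem apply_self (hF : IsFactorization A ι J Jstar) (x : E) :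
    (J ∘L Jstar) x x = ((‖Jstar x‖ ^ 2 : ℝ) : ℂ) := by
  rw [ContinuousLinearMap.comp_apply, hF.adjoint, inner_self_eq_norm_sq_to_K]
  norm_cast

theorem isPositiveExtension (hF : IsFactorization A ι J Jstar) :
    IsPositiveExtension A (J ∘L Jstar) := by
  refine ⟨fun x => ?_, fun x => ?_⟩
  · rw [ContinuousLinearMap.comp_apply, hF.Jstar_apply, hF.map_rangeRestrict]
  · rw [hF.apply_self]
    exact_mod_cast sq_nonneg ‖Jstar x‖

/-- On the dense vectors `k = ι (Az)`, Cauchy–Schwarz for `T` bounds `|⟨Az, x⟩|²` by `‖k‖² ⟨Tx, x⟩`.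
By continuity this holds for all `k`, and `k = J* x` gives `‖J* x‖² ≤ ⟨Tx, x⟩`. -/
theorem minimal (hF : IsFactorization A ι J Jstar) {T : E →L[ℂ] AntiDual E}
    (hT : IsPositiveExtension A T) : IsPositive (T - J ∘L Jstar) := by
  intro x
  have key : ∀ k : H, ‖⟪Jstar x, k⟫_ℂ‖ ^ 2 ≤ ‖k‖ ^ 2 * (T x x).re := by
    refine hF.induction (isClosed_le (by fun_prop) (by fun_prop)) fun z => ?_
    rw [hF.inner_Jstar_range, hF.norm_sq_range, ← hT.1 z]
    exact hT.2.norm_sq_le z x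
  have hle : ‖Jstar x‖ ^ 2 ≤ (T x x).re := by
    have h := key (Jstar x)
    rw [inner_self_eq_norm_sq_to_K] at h
    simp only [Complex.coe_algebraMap, norm_pow, Complex.norm_real, norm_norm] at h
    rcases (sq_nonneg ‖Jstar x‖).eq_or_lt with h0 | h0
    · rw [← h0]
      exact (Complex.nonneg_iff.1 (hT.2 x)).1
    · exact le_of_mul_le_mul_left (by linarith) h0
  have hx : T x x = (((T x x).re : ℝ) : ℂ) :=
    Complex.ext rfl (Complex.nonneg_iff.1 (hT.2 x)).2.symm
  rw [sub_apply, sub_apply, hF.apply_self, hx, sub_nonneg]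
  exact_mod_cast hle

/-- The infimum is attained: `‖J J*‖` is itself an admissible constant. Conversely an admissible `M`
bounds both `J` and `J*` by `√M`. -/
theorem isGLB_norm (hF : IsFactorization A ι J Jstar) :
    IsGLB {M : ℝ | 0 ≤ M ∧ NormBound A M} ‖J ∘L Jstar‖ := by
  refine ⟨fun M hM => ?_, fun b hb => hb ⟨ContinuousLinearMap.opNorm_nonneg _, hF.isPositiveExtension.normBound⟩⟩
  obtain ⟨hM, hb⟩ := hM
  have hJ : ∀ k : H, ‖J k‖ ≤ √M * ‖k‖ := by
    refine hF.induction (isClosed_le (by fun_prop) (by fun_prop)) fun z => ?_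
    have hz := (ofReal_le_ofReal_mul_iff (hb.nonneg hM z)).1 (hb z)
    rw [← hF.norm_sq_range] at hz
    rw [hF.map_rangeRestrict]
    refine abs_le_of_sq_le_sq' ?_ (by positivity) |>.2
    rwa [mul_pow, Real.sq_sqrt hM]
  have hJs : ∀ x : E, ‖Jstar x‖ ≤ √M * ‖x‖ := fun x => by
    have h1 : ‖Jstar x‖ ^ 2 ≤ √M * ‖Jstar x‖ * ‖x‖ := by
      calc ‖Jstar x‖ ^ 2 = ‖J (Jstar x) x‖ := by
            have := hF.apply_self x
            rw [ContinuousLinearMap.comp_apply] at this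
            rw [this, Complex.norm_real, Real.norm_of_nonneg (sq_nonneg _)]
        _ ≤ ‖J (Jstar x)‖ * ‖x‖ := (J (Jstar x)).le_opNorm x
        _ ≤ _ := by gcongr; exact hJ _
    rcases (norm_nonneg (Jstar x)).eq_or_lt with h0 | h0
    · rw [← h0]
      positivity
    · exact le_of_mul_le_mul_left (by linarith) h0
  refine ContinuousLinearMap.opNorm_le_bound _ hM fun x => ?_
  calc ‖J (Jstar x)‖ ≤ √M * ‖Jstar x‖ := hJ _
    _ ≤ √M * (√M * ‖x‖) := by gcongr; exact hJs x
    _ = M * ‖x‖ := by rw [← mul_assoc, Real.mul_self_sqrt hM]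

end IsFactorization

end Factorization

/-! ### Energy bounds and intertwining -/

/-- A sequence with `q n ^ 2 ≤ q (2 n) q 0` and of exponential growth at rate `L` satisfies
`q 1 ≤ L q 0`. -/
theorem le_mul_of_sq_le_of_le_pow {q : ℕ → ℝ} {K L : ℝ} (hL : 0 < L) (hq : ∀ n, 0 ≤ q n)
    (hsq : ∀ n, q n ^ 2 ≤ q (2 * n) * q 0) (hK : ∀ n, q n ≤ K * L ^ n) : q 1 ≤ L * q 0 := by
  rcases (hq 0).eq_or_lt with h0 | h0
  · have := hsq 1
    rw [← h0, mul_zero] at this ⊢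
    nlinarith
  by_contra! hlt
  set r := q 1 / q 0 with hr
  have hLr : L < r := by rwa [hr, lt_div_iff₀ h0]
  -- Repeated squaring along the powers of two: if `r > L`, then `q (2 ^ n)` would outgrow `K * L ^
  -- (2 ^ n)`.
  have hpow : ∀ n : ℕ, r ^ (2 ^ n) ≤ q (2 ^ n) / q 0 := by
    intro n
    induction n with
    | zero => simp [hr]
    | succ n ih =>
      calc r ^ (2 ^ (n + 1)) = (r ^ (2 ^ n)) ^ 2 := by rw [← pow_mul, pow_succ]
        _ ≤ (q (2 ^ n) / q 0) ^ 2 := by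
          have : 0 ≤ r := hL.le.trans hLr.le
          gcongr
        _ = q (2 ^ n) ^ 2 / q 0 ^ 2 := div_pow _ _ _
        _ ≤ q (2 * 2 ^ n) * q 0 / q 0 ^ 2 := by gcongr; exact hsq _
        _ = q (2 ^ (n + 1)) / q 0 := by rw [← pow_succ']; field_simp
  have hone : 1 < r / L := (one_lt_div hL).2 hLr
  obtain ⟨n, hn⟩ := pow_unbounded_of_one_lt (K / q 0) hone
  have h1 : (r / L) ^ (2 ^ n) ≤ K / q 0 := by
    rw [div_pow, div_le_iff₀ (by positivity)]
    calc r ^ (2 ^ n) ≤ q (2 ^ n) / q 0 := hpow n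
      _ ≤ K * L ^ (2 ^ n) / q 0 := by gcongr; exact hK _
      _ = _ := by ring
  have h2 : (r / L) ^ n ≤ (r / L) ^ (2 ^ n) :=
    pow_le_pow_right₀ hone.le Nat.lt_two_pow_self.le
  linarith

section Intertwining

variable {H : Type u} [NormedAddCommGroup H] [InnerProductSpace ℂ H]
variable {ι : LinearMap.range A.toFun →ₗ[ℂ] H} {J : H →L[ℂ] AntiDual E} {Jstar : E →L[ℂ] H}

namespace IsFactorization

/-- The bound `‖ABx‖_A ≤ L ‖Ax‖_A` for an operator `B` that has a formal adjoint `C` with respect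
to the form of `A`. -/
theorem exists_norm_le (hF : IsFactorization A ι J Jstar) (B C : E →L[ℂ] E)
    (hB : ∀ x ∈ A.domain, B x ∈ A.domain) (hC : ∀ x ∈ A.domain, C x ∈ A.domain)
    (hCB : ∀ x : A.domain, adj C (A x) = A ⟨B x, hB x x.2⟩)
    (hBC : ∀ x : A.domain, adj B (A x) = A ⟨C x, hC x x.2⟩) :
    ∃ L : ℝ, ∀ x : A.domain, ‖ι (A.toFun.rangeRestrict ⟨B x, hB x x.2⟩)‖ ≤
      L * ‖ι (A.toFun.rangeRestrict x)‖ := by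
  set a : A.domain → H := fun x => ι (A.toFun.rangeRestrict x) with ha
  set b : A.domain → A.domain := fun x => ⟨B x, hB x x.2⟩ with hb
  set c : A.domain → A.domain := fun x => ⟨C x, hC x x.2⟩ with hc
  have hin : ∀ x y, ⟪a y, a x⟫_ℂ = A x (y : E) := hF.inner_range
  have hbc : ∀ x y, ⟪a y, a (b x)⟫_ℂ = ⟪a (c y), a x⟫_ℂ := fun x y => by
    rw [hin, hin, ← hCB x, adj_apply]
  have hcb : ∀ x y, ⟪a y, a (c x)⟫_ℂ = ⟪a (b y), a x⟫_ℂ := fun x y => by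
    rw [hin, hin, ← hBC x, adj_apply]
  -- `CB` is symmetric for the energy form, so `‖a (d^[n] x)‖² = |(d^[2n] x | x)|`, which is the
  -- squaring inequality required of `q`.
  set d : A.domain → A.domain := fun x => c (b x) with hd
  have hdd : ∀ x y, ⟪a y, a (d x)⟫_ℂ = ⟪a (d y), a x⟫_ℂ := fun x y => by rw [hcb, hbc]
  have hdn : ∀ n x y, ⟪a y, a (d^[n] x)⟫_ℂ = ⟪a (d^[n] y), a x⟫_ℂ := by
    intro n
    induction n with
    | zero => simp
    | succ n ih =>
      intro x y
      rw [Function.iterate_succ_apply, ih, hdd, ← Function.iterate_succ_apply' d n y]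
  -- The summand `1` only serves to make `L` positive.
  set L : ℝ := ‖C‖ * ‖B‖ + 1 with hLdef
  have hL : 0 < L := by positivity
  have hgrow : ∀ (n : ℕ) (x : A.domain), ‖((d^[n] x : A.domain) : E)‖ ≤ L ^ n * ‖(x : E)‖ := by
    intro n
    induction n with
    | zero => simp
    | succ n ih =>
      intro x
      rw [Function.iterate_succ_apply]
      refine (ih (d x)).trans ?_
      have h1 : ‖((d x : A.domain) : E)‖ ≤ L * ‖(x : E)‖ := by
        calc ‖C (B x)‖ ≤ ‖C‖ * (‖B‖ * ‖(x : E)‖) := C.le_opNorm_of_le (B.le_opNorm x)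
          _ ≤ L * ‖(x : E)‖ := by rw [hLdef]; nlinarith [norm_nonneg (x : E)]
      calc L ^ n * ‖((d x : A.domain) : E)‖ ≤ L ^ n * (L * ‖(x : E)‖) := by gcongr
        _ = _ := by ring
  have hD : ∀ x, ‖a (d x)‖ ≤ L * ‖a x‖ := fun x => by
    refine le_mul_of_sq_le_of_le_pow (q := fun n => ‖a (d^[n] x)‖) (K := ‖Jstar‖ * ‖(x : E)‖) hL
      (fun n => norm_nonneg _) (fun n => ?_) (fun n => ?_)
    · have h1 : ‖a (d^[n] x)‖ ^ 2 = ‖⟪a (d^[2 * n] x), a x⟫_ℂ‖ := by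
        rw [two_mul, Function.iterate_add_apply, ← hdn, inner_self_eq_norm_sq_to_K]
        simp
      change ‖a (d^[n] x)‖ ^ 2 ≤ _
      rw [h1]
      exact norm_inner_le_norm _ _
    -- Boundedness of `J*` transfers growth in `E` to growth in the energy norm.
    · calc ‖a (d^[n] x)‖ = ‖Jstar ((d^[n] x : A.domain) : E)‖ := by rw [hF.Jstar_apply]
        _ ≤ ‖Jstar‖ * (L ^ n * ‖(x : E)‖) := Jstar.le_opNorm_of_le (hgrow n x)
        _ = _ := by ring
  refine ⟨√L, fun x => ?_⟩
  refine abs_le_of_sq_le_sq' ?_ (by positivity) |>.2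
  rw [mul_pow, Real.sq_sqrt hL.le]
  have h1 : ‖a (b x)‖ ^ 2 = ‖⟪a x, a (d x)⟫_ℂ‖ := by
    rw [hcb, inner_self_eq_norm_sq_to_K]
    simp
  calc ‖a (b x)‖ ^ 2 ≤ ‖a x‖ * ‖a (d x)‖ := h1 ▸ norm_inner_le_norm _ _
    _ ≤ ‖a x‖ * (L * ‖a x‖) := by gcongr; exact hD x
    _ = L * ‖a x‖ ^ 2 := by ring

/-- The operator `Ax ↦ ABx = C*Ax` extends continuously to the completion of `ran A`. -/
theorem exists_lift [CompleteSpace H] (hF : IsFactorization A ι J Jstar) (B C : E →L[ℂ] E)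
    (hB : ∀ x ∈ A.domain, B x ∈ A.domain) (hC : ∀ x ∈ A.domain, C x ∈ A.domain)
    (hCB : ∀ x : A.domain, adj C (A x) = A ⟨B x, hB x x.2⟩)
    (hBC : ∀ x : A.domain, adj B (A x) = A ⟨C x, hC x x.2⟩) :
    ∃ S : H →L[ℂ] H, ∀ x : A.domain,
      S (ι (A.toFun.rangeRestrict x)) = ι (A.toFun.rangeRestrict ⟨B x, hB x x.2⟩) := by
  obtain ⟨L, hL⟩ := hF.exists_norm_le B C hB hC hCB hBC
  obtain ⟨S, hS⟩ := exists_extension_of_norm_le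
    ((ι ∘ₗ A.toFun.rangeRestrict) ∘ₗ B.toLinearMap.restrict hB) (ι ∘ₗ A.toFun.rangeRestrict)
    (by
      rw [DenseRange, LinearMap.coe_comp, A.toFun.surjective_rangeRestrict.range_comp]
      exact hF.dense) hL
  exact ⟨S, hS⟩

/-- The lifts `S` of `B` and `S'` of `C` to `H` are mutually adjoint, with `J S = C* J` and `J S' =
B* J`. The adjoint of the latter is `S J* = J* B`, so `C* J J* = J S J* = J J* B`. -/
theorem intertwine [CompleteSpace H] (hF : IsFactorization A ι J Jstar) (B C : E →L[ℂ] E)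
    (hB : ∀ x ∈ A.domain, B x ∈ A.domain) (hC : ∀ x ∈ A.domain, C x ∈ A.domain)
    (hCB : ∀ x : A.domain, adj C (A x) = A ⟨B x, hB x x.2⟩)
    (hBC : ∀ x : A.domain, adj B (A x) = A ⟨C x, hC x x.2⟩) :
    adj C ∘L (J ∘L Jstar) = (J ∘L Jstar) ∘L B := by
  obtain ⟨S, hS⟩ := hF.exists_lift B C hB hC hCB hBC
  obtain ⟨S', hS'⟩ := hF.exists_lift C B hC hB hBC hCB
  have hJS : ∀ k, J (S k) = adj C (J k) := by
    refine hF.induction (isClosed_eq (by fun_prop) (by fun_prop)) fun x => ?_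
    rw [hS, hF.map_rangeRestrict, hF.map_rangeRestrict, hCB]
  have hJS' : ∀ k, J (S' k) = adj B (J k) := by
    refine hF.induction (isClosed_eq (by fun_prop) (by fun_prop)) fun x => ?_
    rw [hS', hF.map_rangeRestrict, hF.map_rangeRestrict, hBC]
  have hadj : ∀ h k, ⟪h, S k⟫_ℂ = ⟪S' h, k⟫_ℂ := fun h => by
    refine hF.induction (isClosed_eq (by fun_prop) (by fun_prop)) fun x => ?_
    refine hF.induction (p := fun h => ⟪h, _⟫_ℂ = ⟪S' h, _⟫_ℂ)
      (isClosed_eq (by fun_prop) (by fun_prop)) (fun z => ?_) h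
    rw [hS, hS', hF.inner_range, hF.inner_range, ← hCB, adj_apply]
  have hSJ : ∀ x, S (Jstar x) = Jstar (B x) := fun x => by
    refine ext_inner_left ℂ fun h => ?_
    rw [hadj, ← inner_conj_symm, ← hF.adjoint, hJS', adj_apply, hF.adjoint, inner_conj_symm]
  ext1 x
  simp only [ContinuousLinearMap.comp_apply]
  rw [← hJS, hSJ]

end IsFactorization

end Intertwining

/-! ### Construction of the extension and the main theorem -/

theorem exists_isKreinVonNeumannExtension {M : ℝ} (hM : 0 ≤ M) (hb : NormBound A M) :
    ∃ T : E →L[ℂ] AntiDual E, IsKreinVonNeumannExtension A T := by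
  have hn := hb.nonneg hM
  obtain ⟨H, _, _, _, κ, hκ, hin⟩ :=
    exists_hilbert_completion (preInnerCore (S := domForm A) hn)
  replace hin : ∀ x y : A.domain, ⟪κ x, κ y⟫_ℂ = A y (x : E) := hin
  -- The completion was formed from `dom A` with the degenerate form `⟨Ax, x'⟩`, where no choice of
  -- preimages arises; since `Ax = 0` implies `κ x = 0`, the map `κ` descends to `ran A`.
  have hker : LinearMap.ker A.toFun ≤ LinearMap.ker κ := fun x hx => by
    have hx : A x = 0 := hx
    rw [LinearMap.mem_ker, ← inner_self_eq_zero (𝕜 := ℂ), hin, hx]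
    rfl
  set ι : LinearMap.range A.toFun →ₗ[ℂ] H :=
    (Submodule.liftQ _ κ hker) ∘ₗ A.toFun.quotKerEquivRange.symm.toLinearMap
  have hι : ∀ x, ι (A.toFun.rangeRestrict x) = κ x := fun x => by
    have : A.toFun.quotKerEquivRange.symm (A.toFun.rangeRestrict x) =
        Submodule.Quotient.mk x := by
      rw [LinearEquiv.symm_apply_eq]
      rfl
    simp only [ι, LinearMap.comp_apply, LinearEquiv.coe_coe]
    rw [this]
    rfl
  have hdense : DenseRange ι := hκ.mono (by
    rintro _ ⟨x, rfl⟩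
    exact ⟨_, hι x⟩)
  have hnorm : ∀ x : A.domain, ‖A.toFun x‖ ≤ √M * ‖κ x‖ := fun x => by
    refine abs_le_of_sq_le_sq' ?_ (by positivity) |>.2
    rw [mul_pow, Real.sq_sqrt hM, norm_sq_eq_re_inner (𝕜 := ℂ) (κ x), hin]
    exact (ofReal_le_ofReal_mul_iff (hn x)).1 (hb x)
  obtain ⟨J, hJ⟩ := exists_extension_of_norm_le A.toFun κ hκ hnorm
  -- `J* x` is the Riesz vector of the functional `h ↦ ⟨Jh, x⟩`. Two conjugate-linear maps are
  -- composed, so `J*` is linear.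
  refine ⟨_, H, _, _, inferInstance, ι, J,
    ((InnerProductSpace.toDual ℂ H).symm.toContinuousLinearEquiv :
      StrongDual ℂ H →L⋆[ℂ] H).comp J.flip, hdense, fun x x' => ?_, fun f => ?_, fun h x => ?_, rfl⟩
  · rw [hι, hι, hin]
  · obtain ⟨f, x, rfl⟩ := f
    exact (congrArg J (hι x)).trans (hJ x)
  · exact (InnerProductSpace.toDual_symm_apply (𝕜 := ℂ) (x := h) (y := J.flip x)).symm

end BanachExtension

open BanachExtension in
theorem theorem4p2 {E : Type u} [NormedAddCommGroup E] [NormedSpace ℂ E] [CompleteSpace E]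
    (A : E →ₗ.[ℂ] AntiDual E) :
    -- the three conditions are equivalent
    List.TFAE
      [∃ T : E →L[ℂ] AntiDual E, IsPositiveExtension A T,
       ∃ M : ℝ, 0 ≤ M ∧ NormBound A M,
       ∀ y : E, ∃ M : ℝ, 0 ≤ M ∧ PointBound A y M] ∧
    -- if they hold, the Krein–von Neumann extension exists, and it has the listed properties
    ((∃ T : E →L[ℂ] AntiDual E, IsPositiveExtension A T) →
      (∃! AN : E →L[ℂ] AntiDual E, IsKreinVonNeumannExtension A AN) ∧
      ∀ AN : E →L[ℂ] AntiDual E, IsKreinVonNeumannExtension A AN →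
        IsPositiveExtension A AN ∧
        (∀ T : E →L[ℂ] AntiDual E, IsPositiveExtension A T → IsPositive (T - AN)) ∧
        IsGLB {M : ℝ | 0 ≤ M ∧ NormBound A M} ‖AN‖ ∧
        ∀ (B C : E →L[ℂ] E)
          (hB : ∀ x ∈ A.domain, B x ∈ A.domain) (hC : ∀ x ∈ A.domain, C x ∈ A.domain),
          (∀ x : A.domain, adj C (A x) = A ⟨B x, hB x x.2⟩) →
          (∀ x : A.domain, adj B (A x) = A ⟨C x, hC x x.2⟩) →
          adj C ∘L AN = AN ∘L B ∧ adj B ∘L AN = AN ∘L C) := by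
  have h12 : (∃ T : E →L[ℂ] AntiDual E, IsPositiveExtension A T) →
      ∃ M : ℝ, 0 ≤ M ∧ NormBound A M := fun ⟨T, hT⟩ => ⟨‖T‖, T.opNorm_nonneg, hT.normBound⟩
  refine ⟨?_, fun hex => ?_⟩
  · tfae_have 1 → 2 := h12
    tfae_have 2 → 1 := by
      rintro ⟨M, hM, hb⟩
      obtain ⟨T, H, _, _, _, ι, J, Jstar, h₁, h₂, h₃, h₄, rfl⟩ :=
        exists_isKreinVonNeumannExtension hM hb
      exact ⟨_, (IsFactorization.mk h₁ h₂ h₃ h₄).isPositiveExtension⟩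
    tfae_have 2 → 3 := fun ⟨M, hM, hb⟩ y => ⟨M * ‖y‖ ^ 2, by positivity, hb.pointBound hM y⟩
    tfae_have 3 → 2 := exists_normBound_of_pointBound
    tfae_finish
  · have hprop : ∀ AN : E →L[ℂ] AntiDual E, IsKreinVonNeumannExtension A AN →
        IsPositiveExtension A AN ∧
          ∀ T : E →L[ℂ] AntiDual E, IsPositiveExtension A T → IsPositive (T - AN) := by
      rintro _ ⟨H, _, _, _, ι, J, Jstar, h₁, h₂, h₃, h₄, rfl⟩
      have hF := IsFactorization.mk h₁ h₂ h₃ h₄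
      exact ⟨hF.isPositiveExtension, fun T hT => hF.minimal hT⟩
    constructor
    · obtain ⟨M, hM, hb⟩ := h12 hex
      obtain ⟨AN, hAN⟩ := exists_isKreinVonNeumannExtension hM hb
      -- Two such operators, possibly built on different spaces `H`, are both smallest positive
      -- extensions, hence equal.
      exact ⟨AN, hAN, fun T hT => eq_of_isPositive_sub ((hprop AN hAN).2 T (hprop T hT).1)
        ((hprop T hT).2 AN (hprop AN hAN).1)⟩
    · intro AN hAN
      refine ⟨(hprop AN hAN).1, (hprop AN hAN).2, ?_⟩
      obtain ⟨H, _, _, _, ι, J, Jstar, h₁, h₂, h₃, h₄, rfl⟩ := hAN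
      have hF := IsFactorization.mk h₁ h₂ h₃ h₄
      exact ⟨hF.isGLB_norm, fun B C hB hC hCB hBC =>
        ⟨hF.intertwine B C hB hC hCB hBC, hF.intertwine C B hC hB hBC hCB⟩⟩
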